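/- Let $\Lambda=\Lambda_0\oplus\Lambda_1$ be a finite-dimensional real supercommutative superalgebra: a unital associative $\mathbb Z/2$-graded $\mathbb R$-algebra such that $ab=(-1)^{\sigma(a)\sigma(b)}ba$ for all homogeneous $a,b$ of parities $\sigma(a),\sigma(b)$. Endow $\Lambda$ with its usual finite-dimensional topology (any norm). Assume that the following bases are given. $(A_0)$ A basis $(e_0=1,e_1,\dots,e_p)$ of $\Lambda_0$ with $\sum_{k=0}^p e_k^2=0$. $(A_1)$ A basis $(\varepsilon_1,\dots,\varepsilon_q)$ of $\Lambda_1$, integers $1=s_1<s_2<\dots<s_r<s_{r+1}=q+1$ and elements $a_1,\dots,a_q\in\Lambda_0$ such that $a_{s_k}=1$ for $1\le k\le r$, $\varepsilon_j=a_j\varepsilon_{s_k}$ whenever $s_k\le j<s_{k+1}$, and $\sum_{j=s_k}^{s_{k+1}-1}a_j^2=0$ for every $k=1,\dots,r$. Write $y=\sum_k y^ke_k\in\Lambda_0$ and $\theta=\sum_j\theta^j\varepsilon_j\in\Lambda_1$ in real coordinates. For a $\Lambda$-valued function $f$ on an open set of $\Lambda_0$, respectively of $\Lambda_1$, that is Fréchet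 differentiable over $\mathbb R$, put $$d''f=\sum_{k=1}^p dy^k\Big(\frac{\partial f}{\partial y^k}-e_k\frac{\partial f}{\partial y^0}\Big),\qquad\text{respectively}\qquad d''f=\sum_{k=1}^r\ \sum_{j=s_k+1}^{s_{k+1}-1}d\theta^j\Big(\frac{\partial f}{\partial\theta^j}-a_j\frac{\partial f}{\partial\theta^{s_k}}\Big).$$ A function $f:D\to\Lambda$ on an open set $D$ of $\Lambda_0$ or of $\Lambda_1$ is called qS-differentiable on $D$ if it is Fréchet differentiable on $D$ and $d''f=0$ at every point of $D$. Let $D$ be an open set of $\Lambda_0$ or of $\Lambda_1$, and let $(f_n)$ be a sequence of qS-differentiable functions on $D$ with values in $\Lambda$ that converges to $f:D\to\Lambda$ uniformly on every compact subset of $D$. Then $f$ is qS-differentiable on $D$. -/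

import Mathlib

namespace Superanalysis

/-- A `ℤ/2`-graded algebra `Λ = Λ₀ ⊕ Λ₁` is supercommutative if the supercommutator
`ab - (-1)^{σ(a)σ(b)} ba` of any two homogeneous elements vanishes. -/
def IsSupercommutative {Λ : Type*} [Ring Λ] [Algebra ℝ Λ] (𝒜 : ZMod 2 → Submodule ℝ Λ) : Prop :=
  ∀ i j : ZMod 2, ∀ a ∈ 𝒜 i, ∀ b ∈ 𝒜 j, a * b = (-1) ^ (i.val * j.val) * (b * a)

section Even

variable {Λ : Type*} [NormedRing Λ] [NormedAlgebra ℝ Λ] {𝒜 : ZMod 2 → Submodule ℝ Λ} {p : ℕ}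

/-- Condition `(A₀)` for a basis `(e₀, …, e_p)` of `Λ₀`: `e₀ = 1` and `∑ e_k² = 0`. -/
def ConditionA0 (e : Module.Basis (Fin (p + 1)) ℝ (𝒜 0)) : Prop :=
  ((e 0 : 𝒜 0) : Λ) = 1 ∧ ∑ k, ((e k : 𝒜 0) : Λ) ^ 2 = 0

/-- The Cauchy-Riemann operator on functions of one variable `y = ∑ y^k e_k ∈ Λ₀`:
`d''f = ∑_{k=1}^p dy^k (∂f/∂y^k - e_k ∂f/∂y^0)`; `∂f/∂y^k` is the derivative along `e_k`. -/
noncomputable def dBarEven (e : Module.Basis (Fin (p + 1)) ℝ (𝒜 0)) (f : 𝒜 0 → Λ) (y : 𝒜 0) :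
    𝒜 0 →ₗ[ℝ] Λ :=
  ∑ k : Fin p, (e.coord k.succ).smulRight
    (fderiv ℝ f y (e k.succ) - ((e k.succ : 𝒜 0) : Λ) * fderiv ℝ f y (e 0))

/-- `f` is qS-differentiable on `D ⊆ Λ₀`: Fréchet differentiable with `d''f = 0` on `D`. -/
def QSDifferentiableOnEven (e : Module.Basis (Fin (p + 1)) ℝ (𝒜 0)) (f : 𝒜 0 → Λ)
    (D : Set (𝒜 0)) : Prop :=
  DifferentiableOn ℝ f D ∧ ∀ y ∈ D, dBarEven e f y = 0

end Even

section Odd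

/-- A basis `(ε_j)` of `Λ₁`, indexed by `0 ≤ j < q`, cut into `r` consecutive nonempty blocks
`s_k ≤ j < s_{k+1}` (`0 = s_0 < s_1 < ⋯ < s_r = q`), with elements `a_j ∈ Λ₀` such that
`a_{s_k} = 1` and `ε_j = a_j ε_{s_k}` for `j` in the `k`-th block. -/
structure OddBlockBasis {Λ : Type*} [Ring Λ] [Algebra ℝ Λ] (𝒜 : ZMod 2 → Submodule ℝ Λ)
    (q r : ℕ) where
  ε : Module.Basis (Fin q) ℝ (𝒜 1)
  s : Fin (r + 1) → ℕ
  s_strictMono : StrictMono s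
  s_zero : s 0 = 0
  s_last : s (Fin.last r) = q
  a : Fin q → Λ
  a_mem : ∀ j, a j ∈ 𝒜 0
  a_start : ∀ (k : Fin r) (j : Fin q), (j : ℕ) = s k.castSucc → a j = 1
  ε_eq : ∀ (k : Fin r) (i j : Fin q), (i : ℕ) = s k.castSucc → s k.castSucc ≤ (j : ℕ) →
    (j : ℕ) < s k.succ → ((ε j : 𝒜 1) : Λ) = a j * ((ε i : 𝒜 1) : Λ)

/-- The first index `s_k` of the `k`-th block, as an element of `Fin q`. -/
def OddBlockBasis.start {Λ : Type*} [Ring Λ] [Algebra ℝ Λ] {𝒜 : ZMod 2 → Submodule ℝ Λ}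
    {q r : ℕ} (B : OddBlockBasis 𝒜 q r) (k : Fin r) : Fin q :=
  ⟨B.s k.castSucc, lt_of_lt_of_eq (B.s_strictMono (Fin.castSucc_lt_last k)) B.s_last⟩

variable {Λ : Type*} [NormedRing Λ] [NormedAlgebra ℝ Λ] {𝒜 : ZMod 2 → Submodule ℝ Λ} {q r : ℕ}

/-- Condition `(A₁)`: the sum of the `a_j²` over each block vanishes. -/
def ConditionA1 (B : OddBlockBasis 𝒜 q r) : Prop :=
  ∀ k : Fin r, ∑ j ∈ Finset.univ.filter
    (fun j : Fin q => B.s k.castSucc ≤ (j : ℕ) ∧ (j : ℕ) < B.s k.succ), B.a j ^ 2 = 0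

/-- The Cauchy-Riemann operator on functions of one variable `θ = ∑ θ^j ε_j ∈ Λ₁`:
`d''f = ∑_k ∑_{s_k < j < s_{k+1}} dθ^j (∂f/∂θ^j - a_j ∂f/∂θ^{s_k})`; `∂f/∂θ^j` is the
derivative along `ε_j`. -/
noncomputable def dBarOdd (B : OddBlockBasis 𝒜 q r) (f : 𝒜 1 → Λ) (θ : 𝒜 1) : 𝒜 1 →ₗ[ℝ] Λ :=
  ∑ k : Fin r, ∑ j ∈ Finset.univ.filter
      (fun j : Fin q => B.s k.castSucc < (j : ℕ) ∧ (j : ℕ) < B.s k.succ),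
    (B.ε.coord j).smulRight
      (fderiv ℝ f θ (B.ε j) - B.a j * fderiv ℝ f θ (B.ε (B.start k)))

/-- `f` is qS-differentiable on `D ⊆ Λ₁`: Fréchet differentiable with `d''f = 0` on `D`. -/
def QSDifferentiableOnOdd (B : OddBlockBasis 𝒜 q r) (f : 𝒜 1 → Λ) (D : Set (𝒜 1)) : Prop :=
  DifferentiableOn ℝ f D ∧ ∀ θ ∈ D, dBarOdd B f θ = 0

end Odd

end Superanalysis

/-!
Both equations `d''f = 0` have the form `∂_j f = A_j ∂_{σ j} f` with `∑_{σ j = i} A_j ^ 2 = 0` for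
all `i`. Integrating by parts twice, a solution `f` is orthogonal to the divergence of every
compactly supported closed vector field. For a radial mollifier `φ` the field `φ(z) z` is closed,
and the derivative in `t` of the dilates `t ^ n φ(t (y - x))` is a divergence of this kind. Hence
`∫ t ^ n φ(t (y - x)) f(x) dx` does not depend on `t`, and `t → ∞` shows that it equals `f(y)`. This
mean value formula, with `t` fixed, passes to locally uniform limits; since its kernel is `C¹`, the
limit is differentiable and the derivatives converge, so the equation survives as well.
-/

namespace Superanalysis

open MeasureTheory Set Filter Topology Metric

section DivergenceTheorem

variable {n : ℕ} {V W : Type*} [NormedAddCommGroup V] [NormedSpace ℝ V]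
  [NormedAddCommGroup W] [NormedSpace ℝ W]

theorem integral_divergence_eq_zero_of_hasCompactSupport
    {w : Fin n → (Fin n → ℝ) → V} {w' : Fin n → (Fin n → ℝ) → (Fin n → ℝ) →L[ℝ] V}
    (hw : ∀ k x, HasFDerivAt (w k) (w' k x) x) (hc : ∀ k, HasCompactSupport (w k))
    (hint : Integrable fun x => ∑ k, w' k x (Pi.single k 1)) :
    ∫ x, ∑ k, w' k x (Pi.single k 1) = 0 := by
  obtain _ | m := n
  · simp
  obtain ⟨R, hR0, hR⟩ := (isCompact_iUnion hc).isBounded.subset_ball_lt 0 0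
  have hsupp : ∀ k x, (∃ i, R ≤ |x i|) → x ∉ tsupport (w k) := fun k x ⟨i, hi⟩ hx =>
    (hi.trans (norm_le_pi_norm x i)).not_gt (mem_ball_zero_iff.1 (hR (mem_iUnion_of_mem k hx)))
  have hbox := integral_divergence_of_hasFDerivAt_off_countable' (fun _ => -R) (fun _ => R)
    (fun _ => by linarith) w w' ∅ countable_empty
    (fun k x _ => (hw k x).continuousAt.continuousWithinAt) (fun x _ k => hw k x)
    hint.integrableOn
  have hfaces : ∀ k (c : ℝ) (x : Fin m → ℝ), R ≤ |c| → w k (k.insertNth c x) = 0 :=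
    fun k c x hc => image_eq_zero_of_notMem_tsupport (hsupp k _ ⟨k, by simpa using hc⟩)
  rw [← setIntegral_eq_integral_of_forall_compl_eq_zero, hbox]
  · simp [hfaces, abs_of_pos hR0]
  · intro x hx
    have hx' : ∃ i, R ≤ |x i| := by
      by_contra! h
      exact hx ⟨fun i => (abs_lt.1 (h i)).1.le, fun i => (abs_lt.1 (h i)).2.le⟩
    exact Finset.sum_eq_zero fun k _ => by
      simp [← (hw k x).fderiv, fderiv_of_notMem_tsupport ℝ (hsupp k x hx')]

theorem continuous_smul_of_tsupport_subset {X : Type*} [TopologicalSpace X] {φ : X → ℝ}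
    {f : X → V} {U : Set X} (hU : IsOpen U) (hf : ContinuousOn f U) (hφ : Continuous φ)
    (hs : tsupport φ ⊆ U) : Continuous fun x => φ x • f x :=
  continuous_of_tsupport fun _ hx =>
    hφ.continuousAt.smul (hf.continuousAt (hU.mem_nhds (hs (tsupport_smul_subset_left φ f hx))))

theorem integrable_fderiv_smul {E : Type*} [NormedAddCommGroup E] [NormedSpace ℝ E]
    [MeasurableSpace E] [OpensMeasurableSpace E] {μ : Measure E} [IsFiniteMeasureOnCompacts μ]
    {φ : E → ℝ} {f : E → V} {U : Set E} (hU : IsOpen U) (hf : ContinuousOn f U)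
    (hφ : ContDiff ℝ 1 φ) (hc : HasCompactSupport φ) (hs : tsupport φ ⊆ U) (v : E) :
    Integrable (fun x => fderiv ℝ φ x v • f x) μ :=
  (continuous_smul_of_tsupport_subset hU hf
    ((hφ.continuous_fderiv one_ne_zero).clm_apply continuous_const)
    ((tsupport_fderiv_apply_subset ℝ v).trans hs)).integrable_of_hasCompactSupport
    ((hc.fderiv_apply ℝ v).smul_right)

theorem hasFDerivAt_smul_of_tsupport_subset {E : Type*} [NormedAddCommGroup E] [NormedSpace ℝ E]
    {φ : E → ℝ} {f : E → V} {U : Set E} (hU : IsOpen U) (hf : DifferentiableOn ℝ f U)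
    (hφ : Differentiable ℝ φ) (hs : tsupport φ ⊆ U) (x : E) :
    HasFDerivAt (fun x => φ x • f x) (φ x • fderiv ℝ f x + (fderiv ℝ φ x).smulRight (f x)) x := by
  by_cases hx : x ∈ tsupport φ
  · exact (hφ x).hasFDerivAt.smul (hf.differentiableAt (hU.mem_nhds (hs hx))).hasFDerivAt
  · rw [image_eq_zero_of_notMem_tsupport hx, fderiv_of_notMem_tsupport ℝ hx, zero_smul, zero_add]
    have h0 : (fun x => φ x • f x) =ᶠ[𝓝 x] fun _ => 0 :=
      (notMem_tsupport_iff_eventuallyEq.1 hx).mono fun y hy => by simp [hy]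
    simpa using (hasFDerivAt_const (0 : V) x).congr_of_eventuallyEq h0

/-- The derivative of `f` need not be locally integrable, but the divergence of the vector field
`φ • a_k f` is continuous. -/
theorem integral_sum_fderiv_smul_eq_zero {a : Fin n → V →L[ℝ] W}
    {f : (Fin n → ℝ) → V} {U : Set (Fin n → ℝ)} (hU : IsOpen U) (hf : DifferentiableOn ℝ f U)
    (hfa : ∀ x ∈ U, ∑ k, a k (fderiv ℝ f x (Pi.single k 1)) = 0) {φ : (Fin n → ℝ) → ℝ}
    (hφ : ContDiff ℝ 1 φ) (hc : HasCompactSupport φ) (hs : tsupport φ ⊆ U) :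
    ∫ x, ∑ k, a k (fderiv ℝ φ x (Pi.single k 1) • f x) = 0 := by
  have hder : ∀ k x, HasFDerivAt (fun x => a k (φ x • f x))
      (a k ∘L (φ x • fderiv ℝ f x + (fderiv ℝ φ x).smulRight (f x))) x := fun k x =>
    (a k).hasFDerivAt.comp x
      (hasFDerivAt_smul_of_tsupport_subset hU hf (hφ.differentiable one_ne_zero) hs x)
  have hdiv : ∀ x, ∑ k, (a k ∘L (φ x • fderiv ℝ f x + (fderiv ℝ φ x).smulRight (f x)))
      (Pi.single k 1) = ∑ k, a k (fderiv ℝ φ x (Pi.single k 1) • f x) := by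
    intro x
    suffices φ x • ∑ k, a k (fderiv ℝ f x (Pi.single k 1)) = 0 by
      simpa [Finset.sum_add_distrib, ← Finset.smul_sum]
    by_cases hx : x ∈ tsupport φ
    · rw [hfa x (hs hx), smul_zero]
    · rw [image_eq_zero_of_notMem_tsupport hx, zero_smul]
  have key := integral_divergence_eq_zero_of_hasCompactSupport hder
    fun k => hc.smul_right.comp_left (map_zero (a k))
  simp only [hdiv] at key
  exact key (integrable_finsetSum _ fun k _ =>
    (a k).integrable_comp (integrable_fderiv_smul hU hf.continuousOn hφ hc hs _))

end DivergenceTheorem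

section FirstOrderSystem

/-- Differentiable solutions of the first order system `∂_j f = A_j ∂_{σ j} f`, where `∂_j` is the
derivative along `b j`. Both `d''f = 0` on `Λ₀` and `d''f = 0` on `Λ₁` have this form. -/
structure IsFirstOrderSolutionOn {ι E V : Type*} [NormedAddCommGroup E] [NormedSpace ℝ E]
    [NormedAddCommGroup V] [NormedSpace ℝ V] (b : ι → E) (A : ι → V →L[ℝ] V) (σ : ι → ι)
    (f : E → V) (D : Set E) : Prop where
  differentiableOn : DifferentiableOn ℝ f D
  fderiv_eq : ∀ y ∈ D, ∀ j, fderiv ℝ f y (b j) = A j (fderiv ℝ f y (b (σ j)))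

namespace IsFirstOrderSolutionOn

variable {n : ℕ} {V : Type*} [NormedAddCommGroup V] [NormedSpace ℝ V] [CompleteSpace V]
  {A : Fin n → V →L[ℝ] V} {σ : Fin n → Fin n} {f : (Fin n → ℝ) → V} {U : Set (Fin n → ℝ)}

theorem integral_fderiv_smul_eq
    (hf : IsFirstOrderSolutionOn (fun j => Pi.single j 1) A σ f U) (hU : IsOpen U)
    {φ : (Fin n → ℝ) → ℝ} (hφ : ContDiff ℝ 1 φ) (hc : HasCompactSupport φ) (hs : tsupport φ ⊆ U)
    (j : Fin n) :
    ∫ x, fderiv ℝ φ x (Pi.single j 1) • f x =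
      A j (∫ x, fderiv ℝ φ x (Pi.single (σ j) 1) • f x) := by
  let a : Fin n → V →L[ℝ] V := Pi.single j (.id ℝ V) - Pi.single (σ j) (A j)
  have ha : ∀ v : Fin n → V, ∑ k, a k (v k) = v j - A j (v (σ j)) := fun v => by
    simp [a, Pi.single_apply, apply_ite DFunLike.coe, ite_apply, Finset.sum_sub_distrib]
  have hint := integrable_fderiv_smul (μ := volume) hU hf.differentiableOn.continuousOn hφ hc hs
  have key := integral_sum_fderiv_smul_eq_zero (a := a) hU hf.differentiableOn
    (fun x hx => by rw [ha, hf.fderiv_eq x hx j, sub_self]) hφ hc hs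
  simp only [ha] at key
  rwa [integral_sub (hint _) ((A j).integrable_comp (hint _)),
    (A j).integral_comp_comm (hint _), sub_eq_zero] at key

/-- Since the field `ψ` is closed, `∫ ∂_j ψ_j • f` can be integrated by parts twice, which yields
`A_j ^ 2` applied to `∫ ∂_i ψ_i • f` with `i = σ j`. -/
theorem integral_divergence_smul_eq_zero
    (hf : IsFirstOrderSolutionOn (fun j => Pi.single j 1) A σ f U) (hU : IsOpen U)
    (hA : ∀ i, ∑ j with σ j = i, A j ^ 2 = 0) {ψ : Fin n → (Fin n → ℝ) → ℝ}
    (hψ : ∀ j, ContDiff ℝ 1 (ψ j)) (hc : ∀ j, HasCompactSupport (ψ j))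
    (hs : ∀ j, tsupport (ψ j) ⊆ U)
    (hclosed : ∀ x i j, fderiv ℝ (ψ j) x (Pi.single i 1) = fderiv ℝ (ψ i) x (Pi.single j 1)) :
    ∫ x, (∑ j, fderiv ℝ (ψ j) x (Pi.single j 1)) • f x = 0 := by
  let I : Fin n → Fin n → V := fun i j => ∫ x, fderiv ℝ (ψ j) x (Pi.single i 1) • f x
  have hsymm : ∀ i j, I i j = I j i := fun i j => by simp only [I, hclosed _ i j]
  have hparts : ∀ i j, I j i = A j (I (σ j) i) := fun i j =>
    hf.integral_fderiv_smul_eq hU (hψ i) (hc i) (hs i) j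
  have hdiag : ∀ j, I j j = (A j ^ 2) (I (σ j) (σ j)) := fun j =>
    calc I j j = A j (I j (σ j)) := by rw [hparts j j, hsymm]
      _ = (A j ^ 2) (I (σ j) (σ j)) := by rw [hparts (σ j) j, pow_two, mul_apply_eq_comp]
  calc ∫ x, (∑ j, fderiv ℝ (ψ j) x (Pi.single j 1)) • f x = ∑ j, I j j := by
        simp only [Finset.sum_smul]
        exact integral_finsetSum _ fun j _ => integrable_fderiv_smul hU
          hf.differentiableOn.continuousOn (hψ j) (hc j) (hs j) _
    _ = ∑ i, ∑ j with σ j = i, I j j := (Finset.sum_fiberwise _ _ _).symm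
    _ = ∑ i, (∑ j with σ j = i, A j ^ 2) (I i i) := by
        refine Finset.sum_congr rfl fun i _ => ?_
        rw [sum_apply]
        refine Finset.sum_congr rfl fun j hj => ?_
        rw [hdiag j, (Finset.mem_filter.1 hj).2]
    _ = 0 := by simp [hA]

end IsFirstOrderSolutionOn

end FirstOrderSystem

theorem tendsto_setIntegral_smul_of_tendstoUniformlyOn {X V κ : Type*} [TopologicalSpace X]
    [T2Space X] [MeasurableSpace X] [OpensMeasurableSpace X] {μ : Measure X}
    [IsFiniteMeasureOnCompacts μ] [NormedAddCommGroup V] [NormedSpace ℝ V] {K : Set X}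
    {l : Filter κ} {F : κ → X → V} {f : X → V} {c : X → ℝ} (hK : IsCompact K)
    (hc : ContinuousOn c K) (hF : ∀ i, ContinuousOn (F i) K) (hf : ContinuousOn f K)
    (hlim : TendstoUniformlyOn F f l K) :
    Tendsto (fun i => ∫ x in K, c x • F i x ∂μ) l (𝓝 (∫ x in K, c x • f x ∂μ)) := by
  have hint : ∀ {h : X → V}, ContinuousOn h K → IntegrableOn (fun x => c x • h x) K μ :=
    fun hh => (hc.smul hh).integrableOn_compact hK
  obtain ⟨C, hC⟩ := hK.exists_bound_of_continuousOn hc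
  refine Metric.tendsto_nhds.2 fun ε hε => ?_
  have hM : 0 < |C| * μ.real K + 1 := by positivity
  filter_upwards [Metric.tendstoUniformlyOn_iff.1 hlim _ (div_pos hε hM)] with i hi
  have hbound : ∀ x ∈ K, ‖c x • (F i x - f x)‖ ≤ |C| * (ε / (|C| * μ.real K + 1)) := by
    intro x hx
    rw [norm_smul, ← dist_eq_norm, dist_comm]
    gcongr
    exacts [(hC x hx).trans (le_abs_self C), (hi x hx).le]
  calc dist (∫ x in K, c x • F i x ∂μ) (∫ x in K, c x • f x ∂μ)
      = ‖∫ x in K, c x • (F i x - f x) ∂μ‖ := by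
        simp only [dist_eq_norm, smul_sub]
        rw [integral_sub (hint (hF i)) (hint hf)]
    _ ≤ |C| * (ε / (|C| * μ.real K + 1)) * μ.real K :=
        norm_setIntegral_le_of_norm_le_const hK.measure_lt_top hbound
    _ = ε * (|C| * μ.real K / (|C| * μ.real K + 1)) := by ring
    _ < ε := mul_lt_of_lt_one_right hε ((div_lt_one hM).2 (lt_add_one _))

section ParametricIntegral

variable {P X V : Type*} [NormedAddCommGroup P] [NormedSpace ℝ P] [NormedAddCommGroup X]
  [NormedSpace ℝ X] [NormedAddCommGroup V] [NormedSpace ℝ V] {K : Set X} {k : P → X → ℝ}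
  {g : X → V}

theorem continuous_fderiv_of_contDiff_uncurry (hk : ContDiff ℝ 1 (Function.uncurry k)) :
    Continuous fun z : P × X => fderiv ℝ (fun p => k p z.2) z.1 := by
  have h : ContDiff ℝ 1 (Function.uncurry fun (z : P × X) p => k p z.2) :=
    hk.comp (contDiff_snd.prodMk (contDiff_snd.comp contDiff_fst))
  exact (h.fderiv (n := 0) contDiff_fst le_rfl).continuous

theorem continuousOn_fderiv_smulRight (hk : ContDiff ℝ 1 (Function.uncurry k))
    (hg : ContinuousOn g K) (p : P) :
    ContinuousOn (fun x => (fderiv ℝ (fun p => k p x) p).smulRight (g x)) K :=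
  ContinuousOn.clm_apply (((ContinuousLinearMap.smulRightL ℝ P V).continuous.comp
    ((continuous_fderiv_of_contDiff_uncurry hk).comp (Continuous.prodMk_right p))).continuousOn) hg

variable [MeasurableSpace X] [OpensMeasurableSpace X] {μ : Measure X} [IsFiniteMeasureOnCompacts μ]

theorem hasFDerivAt_setIntegral_smul (hK : IsCompact K)
    (hk : ContDiff ℝ 1 (Function.uncurry k)) (hg : ContinuousOn g K) (p : P) :
    HasFDerivAt (fun p => ∫ x in K, k p x • g x ∂μ)
      (∫ x in K, (fderiv ℝ (fun p => k p x) p).smulRight (g x) ∂μ) p := by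
  have hk' := continuous_fderiv_of_contDiff_uncurry hk
  have hint : ∀ p, IntegrableOn (fun x => k p x • g x) K μ := fun p =>
    (ContinuousOn.smul (hk.continuous.comp (Continuous.prodMk_right p)).continuousOn
      hg).integrableOn_compact hK
  have hder : ∀ p x, HasFDerivAt (fun p => k p x) (fderiv ℝ (fun p => k p x) p) p := fun p x =>
    ((hk.comp (contDiff_id.prodMk contDiff_const)).differentiable one_ne_zero p).hasFDerivAt
  obtain ⟨C, hC⟩ := hK.exists_bound_of_continuousOn
    (hk'.comp (Continuous.prodMk_right p)).continuousOn
  have hbound : ∀ᶠ p' in 𝓝 p, ∀ x ∈ K, ‖fderiv ℝ (fun p => k p x) p'‖ < C + 1 :=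
    hK.eventually_forall_of_forall_eventually fun x hx =>
      hk'.norm.continuousAt.eventually_lt_const ((hC x hx).trans_lt (lt_add_one C))
  refine hasFDerivAt_integral_of_dominated_of_fderiv_le (bound := fun x => (C + 1) * ‖g x‖) hbound
    (.of_forall fun p => (hint p).aestronglyMeasurable) (hint p)
    (F' := fun p x => (fderiv ℝ (fun p => k p x) p).smulRight (g x))
    ((continuousOn_fderiv_smulRight hk hg p).aestronglyMeasurable_of_isCompact hK
      hK.measurableSet) ?_ ((hg.integrableOn_compact hK).norm.const_mul _)
    (.of_forall fun x p' _ => (hder p' x).smul_const (g x))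
  refine (ae_restrict_iff' hK.measurableSet).2 (.of_forall fun x hx p' hp' => ?_)
  rw [ContinuousLinearMap.norm_smulRight_apply]
  exact mul_le_mul_of_nonneg_right (hp' x hx).le (norm_nonneg _)

theorem fderiv_setIntegral_smul_apply (hK : IsCompact K)
    (hk : ContDiff ℝ 1 (Function.uncurry k)) (hg : ContinuousOn g K) (p v : P) :
    fderiv ℝ (fun p => ∫ x in K, k p x • g x ∂μ) p v =
      ∫ x in K, fderiv ℝ (fun p => k p x) p v • g x ∂μ := by
  rw [(hasFDerivAt_setIntegral_smul hK hk hg p).fderiv, ContinuousLinearMap.integral_apply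
    ((continuousOn_fderiv_smulRight hk hg p).integrableOn_compact hK)]
  simp only [ContinuousLinearMap.smulRight_apply]

/-- The `C¹` kernel passes its smoothness on to the limit `g`, along with the convergence of the
derivatives, although the functions `F i` converge only uniformly. -/
theorem differentiableAt_and_tendsto_fderiv_of_eventually_eq_setIntegral_smul {κ : Type*}
    {l : Filter κ} [l.NeBot] (hK : IsCompact K) (hk : ContDiff ℝ 1 (Function.uncurry k))
    {F : κ → X → V} {f : X → V} (hF : ∀ i, ContinuousOn (F i) K) (hf : ContinuousOn f K)
    (hlim : TendstoUniformlyOn F f l K) {G : κ → P → V} {g : P → V} {p : P}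
    (hG : ∀ᶠ z in 𝓝 p, ∀ i, G i z = ∫ x in K, k z x • F i x ∂μ)
    (hg : ∀ᶠ z in 𝓝 p, Tendsto (fun i => G i z) l (𝓝 (g z))) :
    DifferentiableAt ℝ g p ∧
      ∀ v, Tendsto (fun i => fderiv ℝ (G i) p v) l (𝓝 (fderiv ℝ g p v)) := by
  have hg' : g =ᶠ[𝓝 p] fun z => ∫ x in K, k z x • f x ∂μ := by
    filter_upwards [hG, hg] with z hGz hgz
    exact tendsto_nhds_unique hgz <| (tendsto_setIntegral_smul_of_tendstoUniformlyOn hK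
      (hk.continuous.comp (Continuous.prodMk_right z)).continuousOn hF hf hlim).congr
      fun i => (hGz i).symm
  have hG' : ∀ i, G i =ᶠ[𝓝 p] fun z => ∫ x in K, k z x • F i x ∂μ := fun i =>
    hG.mono fun z hz => hz i
  refine ⟨((hasFDerivAt_setIntegral_smul hK hk hf p).congr_of_eventuallyEq hg').differentiableAt,
    fun v => ?_⟩
  simp only [(hG' _).fderiv_eq, hg'.fderiv_eq, fderiv_setIntegral_smul_apply hK hk hf,
    fderiv_setIntegral_smul_apply hK hk (hF _)]
  exact tendsto_setIntegral_smul_of_tendstoUniformlyOn hK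
    (((continuous_fderiv_of_contDiff_uncurry hk).comp
      (Continuous.prodMk_right p)).clm_apply continuous_const).continuousOn hF hf hlim

end ParametricIntegral

section RadialKernels

variable {n : ℕ}

/-- The gradient of `φ` at `x` is parallel to `x`, as it is for functions of `∑ x_i ^ 2`. This is
exactly what makes the vector field `x ↦ φ x • x` closed. -/
def HasRadialGradient (φ : (Fin n → ℝ) → ℝ) : Prop :=
  ∀ x i j, x i * fderiv ℝ φ x (Pi.single j 1) = x j * fderiv ℝ φ x (Pi.single i 1)

theorem HasRadialGradient.comp_smul {φ : (Fin n → ℝ) → ℝ} (hφ : HasRadialGradient φ) (t : ℝ) :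
    HasRadialGradient fun x => φ (t • x) := fun x i j => by
  simpa [fderiv_comp_smul, mul_assoc, mul_left_comm] using hφ (t • x) i j

theorem hasRadialGradient_comp_sum_sq {η : ℝ → ℝ} (hη : Differentiable ℝ η) :
    HasRadialGradient fun x : Fin n → ℝ => η (∑ i, x i ^ 2) := fun x i j => by
  have hsq : HasFDerivAt (fun x : Fin n → ℝ => ∑ i, x i ^ 2)
      (∑ i, (2 * x i) • ContinuousLinearMap.proj (R := ℝ) (φ := fun _ : Fin n => ℝ) i) x :=
    HasFDerivAt.fun_sum fun i _ => by
      simpa using (hasFDerivAt_apply (𝕜 := ℝ) (F' := fun _ : Fin n => ℝ) i x).pow 2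
  have h := (hη (∑ i, x i ^ 2)).hasDerivAt.comp_hasFDerivAt x hsq
  rw [HasFDerivAt.fderiv (f := fun x : Fin n → ℝ => η (∑ i, x i ^ 2)) h]
  simp only [smul_apply, sum_apply, ContinuousLinearMap.proj_apply, Pi.single_apply, smul_eq_mul,
    mul_ite, mul_one, mul_zero, Finset.sum_ite_eq', Finset.mem_univ, ↓reduceIte]
  ring

theorem fderiv_sub_coord_mul_comp_sub {φ : (Fin n → ℝ) → ℝ} (hφ : Differentiable ℝ φ)
    (y x v : Fin n → ℝ) (j : Fin n) :
    fderiv ℝ (fun x => (y - x) j * φ (y - x)) x v =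
      -((y - x) j * fderiv ℝ φ (y - x) v + v j * φ (y - x)) := by
  have hsub : HasFDerivAt (fun x => y - x) (-.id ℝ (Fin n → ℝ)) x := (hasFDerivAt_id x).const_sub y
  have h := ((hasFDerivAt_apply (𝕜 := ℝ) (F' := fun _ : Fin n => ℝ) j (y - x)).mul
    (hφ (y - x)).hasFDerivAt).comp x hsub
  rw [HasFDerivAt.fderiv (f := fun x => (y - x) j * φ (y - x)) h]
  simp only [Pi.sub_apply, ContinuousLinearMap.comp_neg, ContinuousLinearMap.comp_id, add_apply,
    neg_apply, smul_apply, ContinuousLinearMap.proj_apply, smul_eq_mul]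
  ring

theorem tsupport_comp_sub_subset_closedBall {E : Type*} [SeminormedAddCommGroup E] {φ : E → ℝ}
    {r : ℝ} (hs : tsupport φ ⊆ closedBall 0 r) (y : E) :
    tsupport (fun x => φ (y - x)) ⊆ closedBall y r := by
  refine (tsupport_comp_subset_preimage φ (continuous_const.sub continuous_id)).trans fun x hx => ?_
  rw [mem_closedBall, dist_comm, dist_eq_norm, ← mem_closedBall_zero_iff]
  exact hs hx

variable {V : Type*} [NormedAddCommGroup V] [NormedSpace ℝ V] [CompleteSpace V]
  {A : Fin n → V →L[ℝ] V} {σ : Fin n → Fin n} {f : (Fin n → ℝ) → V} {U : Set (Fin n → ℝ)}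

theorem IsFirstOrderSolutionOn.integral_radial_smul_eq_zero
    (hf : IsFirstOrderSolutionOn (fun j => Pi.single j 1) A σ f U) (hU : IsOpen U)
    (hA : ∀ i, ∑ j with σ j = i, A j ^ 2 = 0) {φ : (Fin n → ℝ) → ℝ} (hφ : ContDiff ℝ 1 φ)
    (hrad : HasRadialGradient φ) {r : ℝ} (hs : tsupport φ ⊆ closedBall 0 r) {y : Fin n → ℝ}
    (hy : closedBall y r ⊆ U) :
    ∫ x, (n * φ (y - x) + fderiv ℝ φ (y - x) (y - x)) • f x = 0 := by
  have hfield := fderiv_sub_coord_mul_comp_sub (hφ.differentiable one_ne_zero) y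
  have hsupp : ∀ j : Fin n, tsupport (fun x => (y - x) j * φ (y - x)) ⊆ closedBall y r := fun j =>
    (tsupport_mul_subset_right (f := fun x : Fin n → ℝ => (y - x) j)).trans
      (tsupport_comp_sub_subset_closedBall hs y)
  have key := hf.integral_divergence_smul_eq_zero hU hA
    (ψ := fun j x => (y - x) j * φ (y - x)) (fun j => by fun_prop)
    (fun j => (isCompact_closedBall y r).of_isClosed_subset (isClosed_tsupport _) (hsupp j))
    (fun j => (hsupp j).trans hy) fun x i j => by
      rw [hfield, hfield, hrad]
      simp [Pi.single_apply, eq_comm]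
  have hcoord : ∀ z, ∑ j, z j * fderiv ℝ φ z (Pi.single j 1) = fderiv ℝ φ z z := fun z => by
    simpa only [map_sum, map_smul, smul_eq_mul] using
      (congrArg (fderiv ℝ φ z) (pi_eq_sum_univ' z)).symm
  have hdiv : ∀ x, ∑ j, fderiv ℝ (fun x => (y - x) j * φ (y - x)) x (Pi.single j 1) =
      -(n * φ (y - x) + fderiv ℝ φ (y - x) (y - x)) := fun x => by
    simp only [hfield, Finset.sum_neg_distrib, Finset.sum_add_distrib, hcoord, Pi.single_eq_same,
      one_mul, Finset.sum_const, Finset.card_univ, Fintype.card_fin, nsmul_eq_mul]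
    ring
  simpa only [hdiv, neg_smul, integral_neg, neg_eq_zero] using key

end RadialKernels

section Mollifier

variable {n : ℕ}

/-- A `C¹` kernel of mass one in the unit ball, whose dilates `t ^ n * φ (t • x)`, `t → ∞`,
approximate the identity; the radial gradient makes convolution with them independent of `t`. -/
structure IsRadialMollifier (φ : (Fin n → ℝ) → ℝ) : Prop where
  contDiff : ContDiff ℝ 1 φ
  nonneg : ∀ x, 0 ≤ φ x
  tsupport_subset : tsupport φ ⊆ closedBall 0 1
  integral_eq_one : ∫ x, φ x = 1
  hasRadialGradient : HasRadialGradient φ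

theorem tsupport_comp_sum_sq_subset_closedBall {η : ℝ → ℝ} (hη : ∀ u, 1 ≤ u → η u = 0) :
    tsupport (fun x : Fin n → ℝ => η (∑ i, x i ^ 2)) ⊆ closedBall 0 1 := by
  refine closure_minimal (fun x hx => ?_) isClosed_closedBall
  have hsum : ∑ i, x i ^ 2 < 1 := lt_of_not_ge fun h => hx (hη _ h)
  rw [mem_closedBall_zero_iff, pi_norm_le_iff_of_nonneg zero_le_one]
  intro i
  rw [Real.norm_eq_abs, ← sq_le_one_iff_abs_le_one]
  exact (Finset.single_le_sum (f := fun i => x i ^ 2) (fun i _ => sq_nonneg _)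
    (Finset.mem_univ i)).trans hsum.le

theorem exists_isRadialMollifier (n : ℕ) : ∃ φ : (Fin n → ℝ) → ℝ, IsRadialMollifier φ := by
  let η : ℝ → ℝ := fun u => Real.smoothTransition (1 - u)
  have hη : ContDiff ℝ 1 η := Real.smoothTransition.contDiff.comp (contDiff_const.sub contDiff_id)
  let φ : (Fin n → ℝ) → ℝ := fun x => η (∑ i, x i ^ 2)
  have hφ : ContDiff ℝ 1 φ := hη.comp (by fun_prop)
  have hφ0 : ∀ x, 0 ≤ φ x := fun x => Real.smoothTransition.nonneg _
  have hs : tsupport φ ⊆ closedBall 0 1 := tsupport_comp_sum_sq_subset_closedBall fun u hu =>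
    Real.smoothTransition.zero_of_nonpos (sub_nonpos.2 hu)
  have hpos : 0 < ∫ x, φ x :=
    hφ.continuous.integral_pos_of_hasCompactSupport_nonneg_nonzero
      ((isCompact_closedBall 0 1).of_isClosed_subset (isClosed_tsupport φ) hs) hφ0 (x := 0)
      (by simp [φ, η])
  let c : ℝ := (∫ x, φ x)⁻¹
  exact ⟨fun x => c * φ x,
    { contDiff := contDiff_const.mul hφ
      nonneg := fun x => mul_nonneg (inv_nonneg.2 hpos.le) (hφ0 x)
      tsupport_subset := (tsupport_mul_subset_right (f := fun _ => c)).trans hs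
      integral_eq_one := by rw [integral_const_mul, inv_mul_cancel₀ hpos.ne']
      hasRadialGradient :=
        hasRadialGradient_comp_sum_sq (η := fun u => c * η u)
          ((hη.differentiable one_ne_zero).const_mul c) }⟩

theorem tsupport_comp_smul_subset_closedBall {E : Type*} [NormedAddCommGroup E] [NormedSpace ℝ E]
    {φ : E → ℝ} {r : ℝ} (hs : tsupport φ ⊆ closedBall 0 r) {t : ℝ} (ht : 0 < t) :
    tsupport (fun x => φ (t • x)) ⊆ closedBall 0 (t⁻¹ * r) := by
  refine (tsupport_comp_subset_preimage φ (continuous_const_smul t)).trans fun x hx => ?_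
  have h : ‖t • x‖ ≤ r := mem_closedBall_zero_iff.1 (hs hx)
  rwa [norm_smul, Real.norm_of_nonneg ht.le, ← le_inv_mul_iff₀ ht, ← mem_closedBall_zero_iff] at h

theorem hasDerivAt_pow_mul_comp_smul {E : Type*} [NormedAddCommGroup E] [NormedSpace ℝ E]
    {φ : E → ℝ} (hφ : Differentiable ℝ φ) (n : ℕ) {t : ℝ} (ht : t ≠ 0) (z : E) :
    HasDerivAt (fun t => t ^ n * φ (t • z))
      (t ^ n * t⁻¹ * (n * φ (t • z) + fderiv ℝ (fun x => φ (t • x)) z z)) t := by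
  have hφ' : HasDerivAt (fun t : ℝ => φ (t • z)) (fderiv ℝ φ (t • z) z) t := by
    simpa only [id, one_smul, Function.comp_def] using
      (hφ (t • z)).hasFDerivAt.comp_hasDerivAt t ((hasDerivAt_id t).smul_const z)
  refine ((hasDerivAt_pow n t).mul hφ').congr_deriv ?_
  have hpow : (n : ℝ) * t ^ (n - 1) = t ^ n * t⁻¹ * n := by
    cases n with
    | zero => simp
    | succ m => rw [Nat.add_sub_cancel, pow_succ, mul_inv_cancel_right₀ ht, mul_comm]
  rw [hpow, fderiv_comp_smul, smul_apply, smul_eq_mul]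
  field_simp

end Mollifier

section ReproducingKernel

variable {n : ℕ} {φ : (Fin n → ℝ) → ℝ} {V : Type*} [NormedAddCommGroup V] [NormedSpace ℝ V]
  [CompleteSpace V] {f : (Fin n → ℝ) → V} {K : Set (Fin n → ℝ)} {y : Fin n → ℝ}

theorem IsRadialMollifier.tendsto_norm_pow_mul (hφ : IsRadialMollifier φ) :
    Tendsto (fun x => ‖x‖ ^ Module.finrank ℝ (Fin n → ℝ) * φ x) (Bornology.cobounded _) (𝓝 0) := by
  refine tendsto_const_nhds.congr' ?_
  filter_upwards [Bornology.isBounded_def.1 (isBounded_closedBall (x := 0) (r := 1))] with x hx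
  rw [image_eq_zero_of_notMem_tsupport fun h => hx (hφ.tsupport_subset h), mul_zero]

theorem IsRadialMollifier.tendsto_setIntegral_smul (hφ : IsRadialMollifier φ) (hK : IsCompact K)
    (hy : K ∈ 𝓝 y) (hf : ContinuousOn f K) :
    Tendsto (fun t : ℝ => ∫ x in K, (t ^ n * φ (t • (y - x))) • f x) atTop (𝓝 (f y)) := by
  have hcont : ContinuousAt (K.indicator f) y :=
    (hf.continuousAt hy).congr (eventuallyEq_of_mem hy eqOn_indicator.symm)
  have h := tendsto_integral_comp_smul_smul_of_integrable' hφ.nonneg hφ.integral_eq_one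
    hφ.tendsto_norm_pow_mul ((hf.integrableOn_compact hK).integrable_indicator hK.measurableSet)
    hcont
  rw [Module.finrank_fin_fun, indicator_of_mem (mem_of_mem_nhds hy)] at h
  simpa only [← integral_indicator hK.measurableSet, indicator_smul] using h

variable {A : Fin n → V →L[ℝ] V} {σ : Fin n → Fin n} {U : Set (Fin n → ℝ)}

theorem IsFirstOrderSolutionOn.setIntegral_radial_smul_eq_zero
    (hf : IsFirstOrderSolutionOn (fun j => Pi.single j 1) A σ f U) (hU : IsOpen U)
    (hA : ∀ i, ∑ j with σ j = i, A j ^ 2 = 0) (hφ : ContDiff ℝ 1 φ)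
    (hrad : HasRadialGradient φ) {r : ℝ} (hs : tsupport φ ⊆ closedBall 0 r)
    (hy : closedBall y r ⊆ K) (hK : K ⊆ U) :
    ∫ x in K, (n * φ (y - x) + fderiv ℝ φ (y - x) (y - x)) • f x = 0 := by
  rw [setIntegral_eq_integral_of_forall_compl_eq_zero fun x hx => ?_]
  · exact hf.integral_radial_smul_eq_zero hU hA hφ hrad hs (hy.trans hK)
  have hx' : y - x ∉ tsupport φ := fun h => hx <| hy <| by
    rw [mem_closedBall, dist_comm, dist_eq_norm, ← mem_closedBall_zero_iff]
    exact hs h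
  rw [image_eq_zero_of_notMem_tsupport hx', fderiv_of_notMem_tsupport ℝ hx']
  simp

theorem IsFirstOrderSolutionOn.hasDerivAt_setIntegral_mollifier
    (hf : IsFirstOrderSolutionOn (fun j => Pi.single j 1) A σ f U) (hU : IsOpen U)
    (hA : ∀ i, ∑ j with σ j = i, A j ^ 2 = 0) (hφ : IsRadialMollifier φ) (hK : IsCompact K)
    (hKU : K ⊆ U) {t : ℝ} (ht : 0 < t) (hy : closedBall y t⁻¹ ⊆ K) :
    HasDerivAt (fun t : ℝ => ∫ x in K, (t ^ n * φ (t • (y - x))) • f x) 0 t := by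
  have hφ' := hφ.contDiff
  have hk : ContDiff ℝ 1 (Function.uncurry fun (t : ℝ) x => t ^ n * φ (t • (y - x))) := by
    simp only [Function.uncurry_def]
    fun_prop
  have hfK := hf.differentiableOn.continuousOn.mono hKU
  have h := hasFDerivAt_setIntegral_smul (μ := volume) hK hk hfK t
  have hder : ∀ x, fderiv ℝ (fun t : ℝ => t ^ n * φ (t • (y - x))) t 1 = t ^ n * t⁻¹ *
      (n * φ (t • (y - x)) + fderiv ℝ (fun x => φ (t • x)) (y - x) (y - x)) := fun x => by
    rw [fderiv_apply_one_eq_deriv]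
    exact (hasDerivAt_pow_mul_comp_smul (hφ'.differentiable one_ne_zero) n ht.ne' _).deriv
  refine h.hasDerivAt.congr_deriv ?_
  rw [← h.fderiv, fderiv_setIntegral_smul_apply hK hk hfK]
  simp only [hder, mul_smul (t ^ n * t⁻¹)]
  rw [integral_smul, hf.setIntegral_radial_smul_eq_zero (φ := fun x => φ (t • x)) hU hA
    (hφ'.comp (contDiff_const_smul t)) (hφ.hasRadialGradient.comp_smul t)
    (tsupport_comp_smul_subset_closedBall hφ.tsupport_subset ht) (by rwa [mul_one]) hKU, smul_zero]

theorem IsFirstOrderSolutionOn.setIntegral_mollifier_eq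
    (hf : IsFirstOrderSolutionOn (fun j => Pi.single j 1) A σ f U) (hU : IsOpen U)
    (hA : ∀ i, ∑ j with σ j = i, A j ^ 2 = 0) (hφ : IsRadialMollifier φ) (hK : IsCompact K)
    (hKU : K ⊆ U) {t : ℝ} (ht : 0 < t) (hy : closedBall y t⁻¹ ⊆ K) :
    ∫ x in K, (t ^ n * φ (t • (y - x))) • f x = f y := by
  have hder : ∀ s, t ≤ s →
      HasDerivAt (fun t : ℝ => ∫ x in K, (t ^ n * φ (t • (y - x))) • f x) 0 s := fun s hs =>
    hf.hasDerivAt_setIntegral_mollifier hU hA hφ hK hKU (ht.trans_le hs)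
      ((closedBall_subset_closedBall (inv_anti₀ ht hs)).trans hy)
  refine tendsto_nhds_unique (tendsto_const_nhds.congr' ?_) <|
    hφ.tendsto_setIntegral_smul hK (mem_of_superset (closedBall_mem_nhds y (inv_pos.2 ht)) hy)
      (hf.differentiableOn.continuousOn.mono hKU)
  filter_upwards [eventually_ge_atTop t] with s hs
  exact (constant_of_has_deriv_right_zero
    (fun u hu => (hder u hu.1).continuousAt.continuousWithinAt)
    (fun u hu => (hder u hu.1).hasDerivWithinAt) s ⟨hs, le_rfl⟩).symm

theorem exists_reproducing_kernel (hU : IsOpen U) (hA : ∀ i, ∑ j with σ j = i, A j ^ 2 = 0)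
    (hy : y ∈ U) :
    ∃ K ⊆ U, IsCompact K ∧ ∃ ρ : (Fin n → ℝ) → ℝ, ContDiff ℝ 1 ρ ∧
      ∀ᶠ z in 𝓝 y, ∀ f, IsFirstOrderSolutionOn (fun j => Pi.single j 1) A σ f U →
        f z = ∫ x in K, ρ (z - x) • f x := by
  obtain ⟨R, hR, hRU⟩ := nhds_basis_closedBall.mem_iff.1 (hU.mem_nhds hy)
  obtain ⟨φ, hφ⟩ := exists_isRadialMollifier n
  let t : ℝ := (R / 2)⁻¹
  refine ⟨closedBall y R, hRU, isCompact_closedBall y R, fun z => t ^ n * φ (t • z),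
    contDiff_const.mul (hφ.contDiff.comp (contDiff_const_smul t)), ?_⟩
  filter_upwards [ball_mem_nhds y (half_pos hR)] with z hz f hf
  refine (hf.setIntegral_mollifier_eq hU hA hφ (isCompact_closedBall y R) hRU
    (inv_pos.2 (half_pos hR)) ?_).symm
  rw [inv_inv]
  exact closedBall_subset_closedBall' (by linarith [mem_ball.1 hz])

end ReproducingKernel

section Limit

variable {n : ℕ} {V : Type*} [NormedAddCommGroup V] [NormedSpace ℝ V] [CompleteSpace V]
  {A : Fin n → V →L[ℝ] V} {σ : Fin n → Fin n} {κ : Type*} {l : Filter κ} [l.NeBot]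

theorem isFirstOrderSolutionOn_pi_of_tendstoUniformlyOn {U : Set (Fin n → ℝ)} (hU : IsOpen U)
    (hA : ∀ i, ∑ j with σ j = i, A j ^ 2 = 0) {F : κ → (Fin n → ℝ) → V} {f : (Fin n → ℝ) → V}
    (hF : ∀ k, IsFirstOrderSolutionOn (fun j => Pi.single j 1) A σ (F k) U)
    (hlim : ∀ K ⊆ U, IsCompact K → TendstoUniformlyOn F f l K) :
    IsFirstOrderSolutionOn (fun j => Pi.single j 1) A σ f U := by
  have hFc : ∀ k, ContinuousOn (F k) U := fun k => (hF k).differentiableOn.continuousOn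
  have hfc : ContinuousOn f U :=
    ((tendstoLocallyUniformlyOn_iff_forall_isCompact hU).2 hlim).continuousOn (.of_forall hFc)
  suffices h : ∀ y ∈ U, DifferentiableAt ℝ f y ∧
      ∀ v, Tendsto (fun k => fderiv ℝ (F k) y v) l (𝓝 (fderiv ℝ f y v)) from
    { differentiableOn := fun y hy => (h y hy).1.differentiableWithinAt
      fderiv_eq := fun y hy j => tendsto_nhds_unique ((h y hy).2 _) <|
        (((A j).continuous.tendsto _).comp ((h y hy).2 _)).congr fun k =>
          ((hF k).fderiv_eq y hy j).symm }
  intro y hy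
  obtain ⟨K, hKU, hK, ρ, hρ, hrep⟩ := exists_reproducing_kernel hU hA hy
  have hk : ContDiff ℝ 1 (Function.uncurry fun z x => ρ (z - x)) := by
    simp only [Function.uncurry_def]
    fun_prop
  refine differentiableAt_and_tendsto_fderiv_of_eventually_eq_setIntegral_smul hK hk
    (fun k => (hFc k).mono hKU) (hfc.mono hKU) (hlim K hKU hK)
    (hrep.mono fun z hz k => hz (F k) (hF k)) ?_
  filter_upwards [hU.mem_nhds hy] with z hz
  exact (hlim {z} (singleton_subset_iff.2 hz) isCompact_singleton).tendsto_at rfl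

theorem IsFirstOrderSolutionOn.comp_continuousLinearEquiv {ι E E' V : Type*}
    [NormedAddCommGroup E] [NormedSpace ℝ E] [NormedAddCommGroup E'] [NormedSpace ℝ E']
    [NormedAddCommGroup V] [NormedSpace ℝ V] {b : ι → E} {A : ι → V →L[ℝ] V} {σ : ι → ι}
    {f : E → V} {D : Set E} (hf : IsFirstOrderSolutionOn b A σ f D) (T : E' ≃L[ℝ] E) :
    IsFirstOrderSolutionOn (fun j => T.symm (b j)) A σ (f ∘ T) (T ⁻¹' D) where
  differentiableOn := hf.differentiableOn.comp T.differentiable.differentiableOn fun _ hx => hx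
  fderiv_eq x hx j := by
    rw [T.comp_right_fderiv]
    simpa using hf.fderiv_eq (T x) hx j

theorem isFirstOrderSolutionOn_of_tendstoUniformlyOn {E : Type*} [NormedAddCommGroup E]
    [NormedSpace ℝ E] (b : Module.Basis (Fin n) ℝ E) (hA : ∀ i, ∑ j with σ j = i, A j ^ 2 = 0)
    {D : Set E} (hD : IsOpen D) {F : κ → E → V} {f : E → V}
    (hF : ∀ k, IsFirstOrderSolutionOn b A σ (F k) D)
    (hlim : ∀ K ⊆ D, IsCompact K → TendstoUniformlyOn F f l K) :
    IsFirstOrderSolutionOn b A σ f D := by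
  have : FiniteDimensional ℝ E := b.finiteDimensional_of_finite
  let T : (Fin n → ℝ) ≃L[ℝ] E := b.equivFun.symm.toContinuousLinearEquiv
  have hT : ∀ j, T.symm (b j) = Pi.single j 1 := fun j => by
    ext i
    simp [T, Pi.single_apply, eq_comm]
  have hTb : ∀ j, T (Pi.single j 1) = b j := fun j => by rw [← hT, T.apply_symm_apply]
  have hF' : ∀ k, IsFirstOrderSolutionOn (fun j => Pi.single j 1) A σ (F k ∘ T) (T ⁻¹' D) :=
    fun k => by simpa only [hT] using (hF k).comp_continuousLinearEquiv T
  have hlim' : ∀ K ⊆ T ⁻¹' D, IsCompact K →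
      TendstoUniformlyOn (fun k => F k ∘ T) (f ∘ T) l K := fun K hK hKc =>
    ((hlim (T '' K) (image_subset_iff.2 hK) (hKc.image T.continuous)).comp T).mono
      (subset_preimage_image _ _)
  have h := (isFirstOrderSolutionOn_pi_of_tendstoUniformlyOn (hD.preimage T.continuous) hA hF'
    hlim').comp_continuousLinearEquiv T.symm
  simpa only [ContinuousLinearEquiv.symm_symm, hTb, Function.comp_assoc,
    ContinuousLinearEquiv.self_comp_symm, Function.comp_id, preimage_preimage,
    ContinuousLinearEquiv.apply_symm_apply, preimage_id'] using h

end Limit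

theorem sum_smulRight_coord_eq_zero_iff {ι R M V : Type*} [CommSemiring R] [AddCommMonoid M]
    [Module R M] [AddCommMonoid V] [Module R V] (b : Module.Basis ι R M) (s : Finset ι)
    (v : ι → V) : ∑ j ∈ s, (b.coord j).smulRight (v j) = 0 ↔ ∀ j ∈ s, v j = 0 := by
  classical
  refine ⟨fun h j hj => ?_, fun h => Finset.sum_eq_zero fun j hj => by simp [h j hj]⟩
  simpa [LinearMap.sum_apply, Finsupp.single_apply, ite_smul, hj] using LinearMap.congr_fun h (b j)

theorem sum_continuousLinearMap_mul_sq_eq_zero {R Λ : Type*} [NontriviallyNormedField R]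
    [SeminormedRing Λ] [NormedAlgebra R Λ] {ι : Type*} {s : Finset ι} {a : ι → Λ}
    (h : ∑ j ∈ s, a j ^ 2 = 0) :
    ∑ j ∈ s, ContinuousLinearMap.mul R Λ (a j) ^ 2 = 0 := by
  ext x
  simp only [sum_apply, pow_two, mul_apply_eq_comp, ContinuousLinearMap.mul_apply', ← mul_assoc,
    ← Finset.sum_mul, zero_apply]
  simp only [← pow_two, h, zero_mul]

section Even

variable {Λ : Type*} [NormedRing Λ] [NormedAlgebra ℝ Λ] {𝒜 : ZMod 2 → Submodule ℝ Λ} {p : ℕ}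
  {e : Module.Basis (Fin (p + 1)) ℝ (𝒜 0)} {D : Set (𝒜 0)}

theorem dBarEven_eq_zero_iff (he : ConditionA0 e) (f : 𝒜 0 → Λ) (y : 𝒜 0) :
    dBarEven e f y = 0 ↔ ∀ j, fderiv ℝ f y (e j) = (e j : Λ) * fderiv ℝ f y (e 0) := by
  have h := sum_smulRight_coord_eq_zero_iff e (Finset.univ.map (Fin.succEmb p))
    fun j => fderiv ℝ f y (e j) - (e j : Λ) * fderiv ℝ f y (e 0)
  rw [Finset.sum_map] at h
  refine h.trans ?_
  simp [Fin.forall_fin_succ, he.1, sub_eq_zero]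

theorem qsDifferentiableOnEven_iff (he : ConditionA0 e) {f : 𝒜 0 → Λ} :
    QSDifferentiableOnEven e f D ↔
      IsFirstOrderSolutionOn e (fun j => ContinuousLinearMap.mul ℝ Λ (e j : Λ)) (fun _ => 0) f D :=
  ⟨fun h => ⟨h.1, fun y hy => (dBarEven_eq_zero_iff he f y).1 (h.2 y hy)⟩,
    fun h => ⟨h.1, fun y hy => (dBarEven_eq_zero_iff he f y).2 (h.2 y hy)⟩⟩

theorem ConditionA0.sum_filter_eq_zero (he : ConditionA0 e) (i : Fin (p + 1)) :
    ∑ j with (0 : Fin (p + 1)) = i, ((e j : 𝒜 0) : Λ) ^ 2 = 0 := by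
  by_cases hi : 0 = i
  · simpa only [hi, Finset.filter_true] using he.2
  · simp only [hi, Finset.filter_false, Finset.sum_empty]

theorem qsDifferentiableOnEven_of_tendstoUniformlyOn [CompleteSpace Λ] (he : ConditionA0 e)
    (hD : IsOpen D) {κ : Type*} {l : Filter κ} [l.NeBot] {F : κ → 𝒜 0 → Λ} {f : 𝒜 0 → Λ}
    (hF : ∀ k, QSDifferentiableOnEven e (F k) D)
    (hlim : ∀ K ⊆ D, IsCompact K → TendstoUniformlyOn F f l K) : QSDifferentiableOnEven e f D := by
  simp only [qsDifferentiableOnEven_iff he] at hF ⊢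
  have hsq := fun i => sum_continuousLinearMap_mul_sq_eq_zero (R := ℝ) (he.sum_filter_eq_zero i)
  exact isFirstOrderSolutionOn_of_tendstoUniformlyOn e hsq hD hF hlim

end Even

namespace OddBlockBasis

variable {Λ : Type*} [Ring Λ] [Algebra ℝ Λ] {𝒜 : ZMod 2 → Submodule ℝ Λ} {q r : ℕ}
  (B : OddBlockBasis 𝒜 q r)

theorem exists_block (j : Fin q) :
    ∃ k : Fin r, B.s k.castSucc ≤ (j : ℕ) ∧ (j : ℕ) < B.s k.succ := by
  by_contra! h
  have hle : ∀ k : Fin (r + 1), B.s k ≤ (j : ℕ) := fun k => by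
    induction k using Fin.induction with
    | zero => simp only [B.s_zero, Nat.zero_le]
    | succ k ih => exact h k ih
  exact (B.s_last ▸ hle (Fin.last r)).not_gt j.2

theorem block_unique {j : ℕ} {k l : Fin r} (hk : B.s k.castSucc ≤ j ∧ j < B.s k.succ)
    (hl : B.s l.castSucc ≤ j ∧ j < B.s l.succ) : k = l := by
  have hle : ∀ {k l : Fin r}, j < B.s k.succ → B.s l.castSucc ≤ j → l ≤ k := fun hk hl =>
    Fin.castSucc_lt_succ_iff.1 (B.s_strictMono.lt_iff_lt.1 (hl.trans_lt hk))
  exact le_antisymm (hle hl.2 hk.1) (hle hk.2 hl.1)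

/-- The index of the block that contains `j`. -/
noncomputable def block (j : Fin q) : Fin r :=
  (B.exists_block j).choose

theorem block_eq_iff (j : Fin q) (k : Fin r) :
    B.block j = k ↔ B.s k.castSucc ≤ (j : ℕ) ∧ (j : ℕ) < B.s k.succ :=
  ⟨fun h => h ▸ (B.exists_block j).choose_spec,
    fun h => B.block_unique (B.exists_block j).choose_spec h⟩

theorem block_start (k : Fin r) : B.block (B.start k) = k :=
  (B.block_eq_iff _ _).2 ⟨le_rfl, B.s_strictMono k.castSucc_lt_succ⟩

theorem lt_and_lt_iff (k : Fin r) (j : Fin q) :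
    (B.s k.castSucc < (j : ℕ) ∧ (j : ℕ) < B.s k.succ) ↔
      B.start (B.block j) ≠ j ∧ B.block j = k := by
  constructor
  · intro hj
    have hb := (B.block_eq_iff j k).2 ⟨hj.1.le, hj.2⟩
    exact ⟨fun h => hj.1.ne (congrArg Fin.val (hb ▸ h)), hb⟩
  · rintro ⟨hne, rfl⟩
    have hj := (B.block_eq_iff j _).1 rfl
    exact ⟨lt_of_le_of_ne hj.1 fun h => hne (Fin.ext h), hj.2⟩

theorem sum_sum_block {M : Type*} [AddCommMonoid M] (g : Fin q → Fin r → M) :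
    ∑ k, ∑ j ∈ Finset.univ.filter (fun j : Fin q => B.s k.castSucc < (j : ℕ) ∧
      (j : ℕ) < B.s k.succ), g j k = ∑ j with B.start (B.block j) ≠ j, g j (B.block j) := by
  rw [← Finset.sum_fiberwise _ B.block]
  refine Finset.sum_congr rfl fun k _ => ?_
  simp only [B.lt_and_lt_iff, Finset.filter_filter]
  exact Finset.sum_congr rfl fun j hj => by rw [(Finset.mem_filter.1 hj).2.2]

end OddBlockBasis

section Odd

variable {Λ : Type*} [NormedRing Λ] [NormedAlgebra ℝ Λ] {𝒜 : ZMod 2 → Submodule ℝ Λ} {q r : ℕ}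
  {B : OddBlockBasis 𝒜 q r} {D : Set (𝒜 1)}

theorem dBarOdd_eq_zero_iff (f : 𝒜 1 → Λ) (θ : 𝒜 1) :
    dBarOdd B f θ = 0 ↔
      ∀ j, fderiv ℝ f θ (B.ε j) = B.a j * fderiv ℝ f θ (B.ε (B.start (B.block j))) := by
  rw [dBarOdd, B.sum_sum_block fun j k => (B.ε.coord j).smulRight
    (fderiv ℝ f θ (B.ε j) - B.a j * fderiv ℝ f θ (B.ε (B.start k))),
    sum_smulRight_coord_eq_zero_iff B.ε _
      fun j => fderiv ℝ f θ (B.ε j) - B.a j * fderiv ℝ f θ (B.ε (B.start (B.block j)))]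
  simp only [Finset.mem_filter, Finset.mem_univ, true_and, sub_eq_zero]
  refine ⟨fun h j => ?_, fun h j _ => h j⟩
  by_cases hj : B.start (B.block j) = j
  · rw [hj, B.a_start (B.block j) j (congrArg Fin.val hj.symm), one_mul]
  · exact h j hj

theorem qsDifferentiableOnOdd_iff {f : 𝒜 1 → Λ} :
    QSDifferentiableOnOdd B f D ↔
      IsFirstOrderSolutionOn B.ε (fun j => ContinuousLinearMap.mul ℝ Λ (B.a j))
        (fun j => B.start (B.block j)) f D :=
  ⟨fun h => ⟨h.1, fun θ hθ => (dBarOdd_eq_zero_iff f θ).1 (h.2 θ hθ)⟩,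
    fun h => ⟨h.1, fun θ hθ => (dBarOdd_eq_zero_iff f θ).2 (h.2 θ hθ)⟩⟩

theorem ConditionA1.sum_filter_eq_zero (hB : ConditionA1 B) (i : Fin q) :
    ∑ j with B.start (B.block j) = i, B.a j ^ 2 = 0 := by
  by_cases hi : B.start (B.block i) = i
  · rw [← hB (B.block i)]
    refine Finset.sum_congr (Finset.filter_congr fun j _ => ?_) fun _ _ => rfl
    rw [← B.block_eq_iff]
    exact ⟨fun h => by rw [← h, B.block_start], fun h => h ▸ hi⟩
  · refine Finset.sum_eq_zero fun j hj => absurd ?_ hi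
    rw [← (Finset.mem_filter.1 hj).2, B.block_start]

theorem qsDifferentiableOnOdd_of_tendstoUniformlyOn [CompleteSpace Λ] (hB : ConditionA1 B)
    (hD : IsOpen D) {κ : Type*} {l : Filter κ} [l.NeBot] {F : κ → 𝒜 1 → Λ} {f : 𝒜 1 → Λ}
    (hF : ∀ k, QSDifferentiableOnOdd B (F k) D)
    (hlim : ∀ K ⊆ D, IsCompact K → TendstoUniformlyOn F f l K) : QSDifferentiableOnOdd B f D := by
  simp only [qsDifferentiableOnOdd_iff] at hF ⊢
  have hsq := fun i => sum_continuousLinearMap_mul_sq_eq_zero (R := ℝ) (hB.sum_filter_eq_zero i)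
  exact isFirstOrderSolutionOn_of_tendstoUniformlyOn B.ε hsq hD hF hlim

end Odd

end Superanalysis

theorem mainTheorem7_general {Λ : Type*} [NormedRing Λ] [NormedAlgebra ℝ Λ] [CompleteSpace Λ]
    {𝒜 : ZMod 2 → Submodule ℝ Λ} {p q r : ℕ} {e : Module.Basis (Fin (p + 1)) ℝ (𝒜 0)}
    (hA0 : Superanalysis.ConditionA0 e) {B : Superanalysis.OddBlockBasis 𝒜 q r}
    (hA1 : Superanalysis.ConditionA1 B) {κ : Type*} {l : Filter κ} [l.NeBot] :
    (∀ (D : Set (𝒜 0)) (F : κ → 𝒜 0 → Λ) (f : 𝒜 0 → Λ), IsOpen D →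
      (∀ k, Superanalysis.QSDifferentiableOnEven e (F k) D) →
      (∀ K ⊆ D, IsCompact K → TendstoUniformlyOn F f l K) →
      Superanalysis.QSDifferentiableOnEven e f D) ∧
    (∀ (D : Set (𝒜 1)) (F : κ → 𝒜 1 → Λ) (f : 𝒜 1 → Λ), IsOpen D →
      (∀ k, Superanalysis.QSDifferentiableOnOdd B (F k) D) →
      (∀ K ⊆ D, IsCompact K → TendstoUniformlyOn F f l K) →
      Superanalysis.QSDifferentiableOnOdd B f D) :=
  ⟨fun _ _ _ hD => Superanalysis.qsDifferentiableOnEven_of_tendstoUniformlyOn hA0 hD,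
    fun _ _ _ hD => Superanalysis.qsDifferentiableOnOdd_of_tendstoUniformlyOn hA1 hD⟩

theorem mainTheorem7 {Λ : Type*} [NormedRing Λ] [NormedAlgebra ℝ Λ] [FiniteDimensional ℝ Λ]
    (𝒜 : ZMod 2 → Submodule ℝ Λ) [GradedAlgebra 𝒜] (hΛ : Superanalysis.IsSupercommutative 𝒜)
    {p q r : ℕ} (e : Module.Basis (Fin (p + 1)) ℝ (𝒜 0)) (hA0 : Superanalysis.ConditionA0 e)
    (B : Superanalysis.OddBlockBasis 𝒜 q r) (hA1 : Superanalysis.ConditionA1 B) :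
    (∀ (D : Set (𝒜 0)) (F : ℕ → 𝒜 0 → Λ) (f : 𝒜 0 → Λ), IsOpen D →
      (∀ n, Superanalysis.QSDifferentiableOnEven e (F n) D) →
      (∀ K ⊆ D, IsCompact K → TendstoUniformlyOn F f Filter.atTop K) →
      Superanalysis.QSDifferentiableOnEven e f D) ∧
    (∀ (D : Set (𝒜 1)) (F : ℕ → 𝒜 1 → Λ) (f : 𝒜 1 → Λ), IsOpen D →
      (∀ n, Superanalysis.QSDifferentiableOnOdd B (F n) D) →
      (∀ K ⊆ D, IsCompact K → TendstoUniformlyOn F f Filter.atTop K) →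
      Superanalysis.QSDifferentiableOnOdd B f D) := by
  have : CompleteSpace Λ := FiniteDimensional.complete ℝ Λ
  exact mainTheorem7_general hA0 hA1
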